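/- Let $\Theta\subset\mathbb{R}\times\mathbb{R}^{d_1}\times\mathbb{R}^{d_2}$ be compact, let $\mathcal{X}\subset\mathbb{R}^{d_1}$ be bounded, let $\mu$ be a probability measure on $\mathbb{R}^{d_1}$ concentrated on $\mathcal{X}$, and let $\tau_1,\tau_2>0$. Let $h(x,\eta)\in\mathbb{R}$ be an expert function that is measurable in $x$ and, over $x\in\mathcal{X}$ and $\eta$ in the projection of $\Theta$ to $\mathbb{R}^{d_2}$, bounded and Lipschitz in $\eta$ with a constant that does not depend on $x$. For a mixing measure $G=\sum_{i=1}^{k'}\exp(\beta_{0i})\,\delta_{(\beta_{1i},\eta_i)}$ put $$g_G(x)=\sum_{i=1}^{k'}\frac{\exp(s_i(x))}{\sum_{j=1}^{k'}\exp(s_j(x))}\,h(x,\eta_i),\qquad s_i(x)=\frac{\beta_{1i}^{\top}x}{(\|\beta_{1i}\|+\tau_1)(\|x\|+\tau_2)}+\beta_{0i},$$ with Euclidean norms. Let $\mathcal{E}_k(\Theta)$ be the set of such $G$ with $k$ atoms and $\mathcal{G}_k(\Theta)$ the set of such $G$ with at least one and at most $k$ atoms, all parameters $(\beta_{0i},\beta_{1i},\eta_i)$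 lying in $\Theta$ in both cases (atoms may coincide). Let $G_*\in\mathcal{E}_{k_*}(\Theta)$ with $k_*\ge1$, and let $Y_i=g_{G_*}(X_i)+\varepsilon_i$, $i=1,2,\ldots$, where the pairs $(X_i,\varepsilon_i)$ are i.i.d., $X_i\sim\mu$, and $\varepsilon_i$ given $X_i$ is $N(0,\sigma^2)$. Then, in the exact-specified setting ($\mathcal{C}=\mathcal{E}_{k_*}(\Theta)$) and in the over-specified setting ($\mathcal{C}=\mathcal{G}_k(\Theta)$ for any fixed $k>k_*$), every least squares estimator $\widetilde G_n$, that is, for each $n$ almost surely $\widetilde G_n\in\operatorname{argmin}_{G\in\mathcal{C}}\sum_{i=1}^n(Y_i-g_G(X_i))^2$, satisfies $$\|g_{\widetilde G_n}-g_{G_*}\|_{L^2(\mu)}=\mathcal{O}_P\big(\sqrt{\log(n)/n}\big),$$ i.e. for every $\delta>0$ there is $C>0$ such that $P\big(\|g_{\widetilde G_n}-g_{G_*}\|_{L^2(\mu)}>C\sqrt{\log(n)/n}\big)\le\delta$ for all sufficiently large $n$. -/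

import Mathlib

open MeasureTheory ProbabilityTheory Filter
open scoped ENNReal NNReal

noncomputable section

/-- A mixing measure `∑ i, exp (β₀ i) • δ_(β₁ i, η i)` on `ℝ^d₁ × ℝ^d₂`, given through its
(finitely many) weights and atoms. -/
structure MixingParam (d₁ d₂ : ℕ) where
  /-- number of atoms (experts) -/
  size : ℕ
  /-- logarithms of the weights -/
  β₀ : Fin size → ℝ
  /-- router part of the atoms (expert embeddings) -/
  β₁ : Fin size → EuclideanSpace ℝ (Fin d₁)
  /-- expert part of the atoms -/
  η : Fin size → EuclideanSpace ℝ (Fin d₂)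

/-- The softmax function `exp (v i) / ∑ j, exp (v j)`. -/
def softmax {k : ℕ} (v : Fin k → ℝ) (i : Fin k) : ℝ :=
  Real.exp (v i) / ∑ j, Real.exp (v j)

/-- The perturbed cosine similarity `β₁ᵀ x / ((‖β₁‖ + τ₁) (‖x‖ + τ₂))`, Euclidean norms. -/
def perturbedCosine {d₁ : ℕ} (τ₁ τ₂ : ℝ) (b x : EuclideanSpace ℝ (Fin d₁)) : ℝ :=
  inner ℝ b x / ((‖b‖ + τ₁) * (‖x‖ + τ₂))

namespace MixingParam

variable {d₁ d₂ : ℕ}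

/-- The measure `∑ i, exp (β₀ i) • δ_(β₁ i, η i)` itself. -/
def toMeasure (G : MixingParam d₁ d₂) :
    Measure (EuclideanSpace ℝ (Fin d₁) × EuclideanSpace ℝ (Fin d₂)) :=
  ∑ i, ENNReal.ofReal (Real.exp (G.β₀ i)) • Measure.dirac (G.β₁ i, G.η i)

/-- All parameter vectors `(β₀ i, β₁ i, η i)` lie in the parameter space `Θ`. -/
def ParamsIn (G : MixingParam d₁ d₂)
    (Θ : Set (ℝ × EuclideanSpace ℝ (Fin d₁) × EuclideanSpace ℝ (Fin d₂))) : Prop :=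
  ∀ i, (G.β₀ i, G.β₁ i, G.η i) ∈ Θ

/-- The regression function `g_G` of the perturbed cosine router mixture of experts. -/
def regression (τ₁ τ₂ : ℝ) (h : EuclideanSpace ℝ (Fin d₁) → EuclideanSpace ℝ (Fin d₂) → ℝ)
    (G : MixingParam d₁ d₂) (x : EuclideanSpace ℝ (Fin d₁)) : ℝ :=
  ∑ i, softmax (fun j => perturbedCosine τ₁ τ₂ (G.β₁ j) x + G.β₀ j) i * h x (G.η i)

theorem integral_toMeasure (G : MixingParam d₁ d₂)
    (f : EuclideanSpace ℝ (Fin d₁) × EuclideanSpace ℝ (Fin d₂) → ℝ) :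
    ∫ w, f w ∂G.toMeasure = ∑ i, Real.exp (G.β₀ i) * f (G.β₁ i, G.η i) := by
  unfold toMeasure
  rw [integral_finsetSum_measure]
  · refine Finset.sum_congr rfl fun i _ => ?_
    rw [integral_smul_measure, integral_dirac, ENNReal.toReal_ofReal (Real.exp_pos _).le,
      smul_eq_mul]
  · intro i _
    exact (integrable_dirac (by simp)).smul_measure ENNReal.ofReal_ne_top

/-- `g_G` depends on the parameters only through the mixing measure, so that minimizing over
parameters and minimizing over mixing measures are the same thing. -/
theorem regression_eq_of_toMeasure_eq (τ₁ τ₂ : ℝ)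
    (h : EuclideanSpace ℝ (Fin d₁) → EuclideanSpace ℝ (Fin d₂) → ℝ)
    {G G' : MixingParam d₁ d₂} (e : G.toMeasure = G'.toMeasure) :
    G.regression τ₁ τ₂ h = G'.regression τ₁ τ₂ h := by
  have key : ∀ (H : MixingParam d₁ d₂) (x : EuclideanSpace ℝ (Fin d₁)),
      H.regression τ₁ τ₂ h x =
        (∫ w, Real.exp (perturbedCosine τ₁ τ₂ w.1 x) * h x w.2 ∂H.toMeasure) /
          ∫ w, Real.exp (perturbedCosine τ₁ τ₂ w.1 x) ∂H.toMeasure := by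
    intro H x
    rw [integral_toMeasure, integral_toMeasure, Finset.sum_div]
    refine Finset.sum_congr rfl fun i _ => ?_
    simp only [softmax, Real.exp_add]
    rw [Finset.sum_congr rfl fun j _ => mul_comm _ (Real.exp (H.β₀ j))]
    ring
  funext x
  rw [key, key, e]

end MixingParam

/-- `𝓔_k(Θ)`: mixing measures with `k` atoms and parameters in `Θ`. -/
def exactClass {d₁ d₂ : ℕ} (k : ℕ)
    (Θ : Set (ℝ × EuclideanSpace ℝ (Fin d₁) × EuclideanSpace ℝ (Fin d₂))) :
    Set (MixingParam d₁ d₂) :=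
  {G | G.size = k ∧ G.ParamsIn Θ}

/-- `𝓖_k(Θ)`: mixing measures with at least one and at most `k` atoms and parameters in `Θ`. -/
def overClass {d₁ d₂ : ℕ} (k : ℕ)
    (Θ : Set (ℝ × EuclideanSpace ℝ (Fin d₁) × EuclideanSpace ℝ (Fin d₂))) :
    Set (MixingParam d₁ d₂) :=
  {G | 1 ≤ G.size ∧ G.size ≤ k ∧ G.ParamsIn Θ}

/-- The least squares criterion `∑_{i < n} (y i - g_G (x i))²` for a sample of size `n`. -/
def leastSquares {d₁ d₂ : ℕ} (τ₁ τ₂ : ℝ)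
    (h : EuclideanSpace ℝ (Fin d₁) → EuclideanSpace ℝ (Fin d₂) → ℝ) (n : ℕ)
    (x : ℕ → EuclideanSpace ℝ (Fin d₁)) (y : ℕ → ℝ) (G : MixingParam d₁ d₂) : ℝ :=
  ∑ i ∈ Finset.range n, (y i - G.regression τ₁ τ₂ h (x i)) ^ 2

/-- `G` minimizes the least squares criterion of the sample over the class `𝓒`. -/
def IsLeastSquares {d₁ d₂ : ℕ} (τ₁ τ₂ : ℝ)
    (h : EuclideanSpace ℝ (Fin d₁) → EuclideanSpace ℝ (Fin d₂) → ℝ)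
    (𝓒 : Set (MixingParam d₁ d₂)) (n : ℕ)
    (x : ℕ → EuclideanSpace ℝ (Fin d₁)) (y : ℕ → ℝ) (G : MixingParam d₁ d₂) : Prop :=
  G ∈ 𝓒 ∧ IsMinOn (leastSquares τ₁ τ₂ h n x y) 𝓒 G

/-- `a n = O_P(b n)`: the ratio `a n / b n` is stochastically bounded (`b n > 0` for large `n`).
No measurability of `a n` is needed: `P` is used as an outer measure. -/
def IsBigOInProbability {Ω : Type*} [MeasurableSpace Ω] (P : Measure Ω)
    (a : ℕ → Ω → ℝ≥0∞) (b : ℕ → ℝ) : Prop :=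
  ∀ δ : ℝ, 0 < δ → ∃ C : ℝ, 0 < C ∧
    ∀ᶠ n in atTop, P {ω | ENNReal.ofReal (C * b n) < a n ω} ≤ ENNReal.ofReal δ

end

/-! The model is well specified, so the rate follows from a one-step net argument, without chaining
or identifiability of the atoms. Write `d` for the difference between a candidate and the true
regression function. Comparing least squares criteria gives `∑ (d² - 2 ε d) ≤ 0` at the estimator.

For a fixed candidate this sum has mean `n ∫ d²`, and its fluctuations are governed by the same
quantity. A Chernoff bound at a constant exponent `l` therefore gives probability at most `exp (l t
- n l ∫ d² / 4)` that the sum is below `t` (`measureReal_sum_excessLoss_le`).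

The regression functions depend on their parameters in a Lipschitz way, uniformly on `𝒳`, so a
uniform `1/n`-net needs only `K n ^ D` elements (`hasPolynomialCover_exactClass`). Replacing the
estimator by a net point raises the sum by `O(1)` once `∑ |ε i| = O(n)`. A union bound over net
points with `∫ d²` at least a large multiple of `log n / n` then beats the factor `n ^ D`
(`isBigOInProbability_leastSquares`). -/

/-! ### Covering numbers in finite dimension -/

/-- A bounded subset of a finite-dimensional space has internal covering numbers that grow at
most polynomially in the inverse radius. -/
theorem exists_finset_cover_card_le_pow {V : Type*} [NormedAddCommGroup V] [NormedSpace ℝ V]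
    [FiniteDimensional ℝ V] {S : Set V} (hS : Bornology.IsBounded S) :
    ∃ K D : ℕ, ∀ n : ℕ, 1 ≤ n → ∃ T : Finset V, ↑T ⊆ S ∧ T.card ≤ K * n ^ D ∧
      ∀ x ∈ S, ∃ y ∈ T, dist x y ≤ 1 / (n : ℝ) := by
  classical
  let e := (Module.finBasis ℝ V).equivFunL
  set D := Module.finrank ℝ V
  obtain ⟨R₀, hR₀⟩ := hS.exists_norm_le
  obtain ⟨c, hc⟩ := exists_nat_gt ‖(e.symm : (Fin D → ℝ) →L[ℝ] V)‖
  obtain ⟨R, hR⟩ := exists_nat_ge (‖(e : V →L[ℝ] (Fin D → ℝ))‖ * R₀)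
  have hc0 : (0 : ℝ) < c := (norm_nonneg _).trans_lt hc
  refine ⟨(2 * R * c + 1) ^ D, D, fun n hn => ?_⟩
  have hn0 : (0 : ℝ) < n := by exact_mod_cast hn
  -- Cells of a coordinate grid of mesh `1 / (c n)`; since `c` exceeds the norm of `e.symm`, two
  -- points of one cell are within `1 / n` in `V`.
  let φ : V → Fin D → ℤ := fun x i => ⌊e x i * (c * n)⌋
  let F : Finset (Fin D → ℤ) :=
    Fintype.piFinset fun _ => Finset.Icc (-((R * c * n : ℕ) : ℤ)) ((R * c * n : ℕ) : ℤ)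
  have hφF : ∀ x ∈ S, φ x ∈ F := by
    intro x hx
    rw [Fintype.mem_piFinset]
    intro i
    have h1 : |e x i| ≤ R := by
      have h2 : ‖e x i‖ ≤ ‖e x‖ := norm_le_pi_norm _ i
      have h3 : ‖e x‖ ≤ ‖(e : V →L[ℝ] (Fin D → ℝ))‖ * ‖x‖ :=
        (e : V →L[ℝ] (Fin D → ℝ)).le_opNorm x
      have h4 := mul_le_mul_of_nonneg_left (hR₀ x hx)
        (norm_nonneg (e : V →L[ℝ] (Fin D → ℝ)))
      rw [Real.norm_eq_abs] at h2
      linarith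
    obtain ⟨h1, h2⟩ := abs_le.1 h1
    have hcn : (0 : ℝ) ≤ c * n := by positivity
    rw [Finset.mem_Icc]
    constructor
    · rw [Int.le_floor]
      push_cast
      nlinarith
    · have : (⌊e x i * (c * n)⌋ : ℝ) ≤ ((R * c * n : ℕ) : ℤ) := by
        refine (Int.floor_le _).trans ?_
        push_cast
        nlinarith
      exact Int.cast_le.1 this
  -- One representative in `S` per occupied cell, which makes the net internal.
  obtain ⟨T, hTS, hT⟩ := (Set.surjOn_image φ S).exists_bijOn_subset
  have himg : φ '' S ⊆ F := by
    rintro _ ⟨x, hx, rfl⟩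
    exact hφF x hx
  have hTfin : T.Finite := by
    refine Set.Finite.of_finite_image ?_ hT.injOn
    rw [hT.image_eq]
    exact F.finite_toSet.subset himg
  refine ⟨hTfin.toFinset, by simpa using hTS, ?_, fun x hx => ?_⟩
  · have hcard : hTfin.toFinset.card ≤ F.card := by
      refine Finset.card_le_card_of_injOn φ (fun x hx => ?_) ?_
      · exact hφF x (hTS (by simpa using hx))
      · simpa using hT.injOn
    refine hcard.trans ?_
    have hF : F.card = (2 * (R * c * n) + 1) ^ D := by
      simp only [F, Fintype.card_piFinset, Int.card_Icc, Finset.prod_const, Finset.card_univ,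
        Fintype.card_fin]
      congr 1
      omega
    rw [hF, ← mul_pow]
    refine Nat.pow_le_pow_left ?_ D
    nlinarith
  · obtain ⟨y, hy, hxy⟩ := hT.surjOn ⟨x, hx, rfl⟩
    refine ⟨y, by simpa using hy, ?_⟩
    have hcn : (0 : ℝ) < c * n := by positivity
    have h1 : ‖e x - e y‖ ≤ 1 / (c * n) := by
      refine (pi_norm_le_iff_of_nonneg (by positivity)).2 fun i => ?_
      have h2 : ⌊e y i * (c * n)⌋ = ⌊e x i * (c * n)⌋ := congrFun hxy i
      have h3 := Int.abs_sub_lt_one_of_floor_eq_floor h2.symm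
      rw [← sub_mul, abs_mul, abs_of_pos hcn] at h3
      rw [Pi.sub_apply, Real.norm_eq_abs, le_div_iff₀ hcn]
      exact h3.le
    have h2 : x - y = e.symm (e x - e y) := by simp
    rw [dist_eq_norm, h2]
    calc ‖e.symm (e x - e y)‖ ≤ ‖(e.symm : (Fin D → ℝ) →L[ℝ] V)‖ * ‖e x - e y‖ :=
          (e.symm : (Fin D → ℝ) →L[ℝ] V).le_opNorm _
      _ ≤ c * (1 / (c * n)) := by gcongr
      _ = 1 / n := by field_simp

/-! ### Parameter stability of the router and of the regression function -/

theorem softmax_nonneg {k : ℕ} (v : Fin k → ℝ) (i : Fin k) : 0 ≤ softmax v i := by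
  unfold softmax
  positivity

theorem sum_exp_pos {k : ℕ} (v : Fin k → ℝ) (i : Fin k) : 0 < ∑ j, Real.exp (v j) :=
  Finset.sum_pos (fun _ _ => Real.exp_pos _) ⟨i, Finset.mem_univ i⟩

/-- An inequality, so that the empty sum `k = 0` is included. -/
theorem sum_softmax_le_one {k : ℕ} (v : Fin k → ℝ) : ∑ i, softmax v i ≤ 1 := by
  unfold softmax
  rw [← Finset.sum_div]
  exact div_self_le_one _

/-- Numerator and denominator each change by a factor of at most `exp r`. -/
theorem softmax_le_exp_mul_softmax {k : ℕ} {v w : Fin k → ℝ} {r : ℝ}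
    (hvw : ∀ i, |v i - w i| ≤ r) (i : Fin k) :
    softmax v i ≤ Real.exp (2 * r) * softmax w i := by
  unfold softmax
  have hv := sum_exp_pos v i
  have hw := sum_exp_pos w i
  have h1 : Real.exp (v i) ≤ Real.exp r * Real.exp (w i) := by
    rw [← Real.exp_add]
    exact Real.exp_le_exp.2 (by linarith [(abs_le.1 (hvw i)).2])
  have h2 : ∑ j, Real.exp (w j) ≤ Real.exp r * ∑ j, Real.exp (v j) := by
    rw [Finset.mul_sum]
    refine Finset.sum_le_sum fun j _ => ?_
    rw [← Real.exp_add]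
    exact Real.exp_le_exp.2 (by linarith [(abs_le.1 (hvw j)).1])
  rw [← mul_div_assoc, div_le_div_iff₀ hv hw]
  calc Real.exp (v i) * ∑ j, Real.exp (w j)
      ≤ (Real.exp r * Real.exp (w i)) * (Real.exp r * ∑ j, Real.exp (v j)) := by gcongr
    _ = _ := by rw [two_mul, Real.exp_add]; ring

/-- The error is relative to the weight, so summing over the atoms costs no factor `k`. The constant
is not sharp. -/
theorem abs_softmax_sub_le {k : ℕ} {v w : Fin k → ℝ} {r : ℝ} (hr : 0 ≤ r) (hr' : r ≤ 1 / 2)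
    (hvw : ∀ i, |v i - w i| ≤ r) (i : Fin k) :
    |softmax v i - softmax w i| ≤ 8 * r * softmax w i := by
  have h1 := softmax_le_exp_mul_softmax hvw i
  have h2 := softmax_le_exp_mul_softmax (v := w) (w := v) (r := r)
    (fun j => by rw [abs_sub_comm]; exact hvw j) i
  have hw := softmax_nonneg w i
  have hv := softmax_nonneg v i
  have h3 : Real.exp (2 * r) - 1 ≤ 4 * r := by
    have h4 := Real.abs_exp_sub_one_le (x := 2 * r) (by rw [abs_of_nonneg] <;> linarith)
    rw [abs_of_nonneg (by linarith : 0 ≤ 2 * r)] at h4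
    linarith [le_abs_self (Real.exp (2 * r) - 1)]
  have h5 : Real.exp (2 * r) * softmax w i ≤ (1 + 4 * r) * softmax w i := by gcongr; linarith
  rw [abs_le]
  constructor
  · have h6 : Real.exp (-(2 * r)) * softmax w i ≤ softmax v i := by
      rw [Real.exp_neg, inv_mul_le_iff₀ (Real.exp_pos _)]
      exact h2
    have h7 : (1 - 2 * r) * softmax w i ≤ Real.exp (-(2 * r)) * softmax w i := by
      gcongr
      linarith [Real.add_one_le_exp (-(2 * r))]
    nlinarith
  · nlinarith

/-- The perturbation `τ₁` removes the singularity of the cosine at `b = 0`, and the factor `‖x‖ +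
τ₂` cancels the growth of the inner product in `x`. -/
theorem abs_perturbedCosine_sub_le {d₁ : ℕ} {τ₁ τ₂ : ℝ} (hτ₁ : 0 < τ₁) (hτ₂ : 0 < τ₂)
    (b b' x : EuclideanSpace ℝ (Fin d₁)) :
    |perturbedCosine τ₁ τ₂ b x - perturbedCosine τ₁ τ₂ b' x| ≤ 2 / τ₁ * ‖b - b'‖ := by
  have hb := norm_nonneg b
  have hb' := norm_nonneg b'
  have hx := norm_nonneg x
  have hB : 0 < ‖b‖ + τ₁ := by positivity
  have hB' : 0 < ‖b'‖ + τ₁ := by positivity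
  have hX : 0 < ‖x‖ + τ₂ := by positivity
  have key : perturbedCosine τ₁ τ₂ b x - perturbedCosine τ₁ τ₂ b' x =
      (inner ℝ (b - b') x * (‖b'‖ + τ₁) + inner ℝ b' x * (‖b'‖ - ‖b‖)) /
        ((‖b‖ + τ₁) * (‖b'‖ + τ₁) * (‖x‖ + τ₂)) := by
    unfold perturbedCosine
    rw [inner_sub_left]
    field_simp
    ring
  rw [key, abs_div, abs_of_pos (by positivity : 0 < (‖b‖ + τ₁) * (‖b'‖ + τ₁) * (‖x‖ + τ₂)),
    div_le_iff₀ (by positivity)]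
  have h1 : |inner ℝ (b - b') x| ≤ ‖b - b'‖ * (‖x‖ + τ₂) :=
    (abs_real_inner_le_norm _ _).trans (by gcongr; linarith)
  have h2 : |inner ℝ b' x| ≤ (‖b'‖ + τ₁) * (‖x‖ + τ₂) :=
    (abs_real_inner_le_norm _ _).trans (by gcongr <;> linarith)
  have h3 : |‖b'‖ - ‖b‖| ≤ ‖b - b'‖ := by
    rw [abs_sub_comm]
    exact abs_norm_sub_norm_le b b'
  calc |inner ℝ (b - b') x * (‖b'‖ + τ₁) + inner ℝ b' x * (‖b'‖ - ‖b‖)|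
      ≤ |inner ℝ (b - b') x| * (‖b'‖ + τ₁) + |inner ℝ b' x| * |‖b'‖ - ‖b‖| := by
        refine (abs_add_le _ _).trans ?_
        rw [abs_mul, abs_mul, abs_of_pos hB']
    _ ≤ ‖b - b'‖ * (‖x‖ + τ₂) * (‖b'‖ + τ₁) + (‖b'‖ + τ₁) * (‖x‖ + τ₂) * ‖b - b'‖ := by
        gcongr
    _ = 2 / τ₁ * ‖b - b'‖ * (τ₁ * (‖b'‖ + τ₁) * (‖x‖ + τ₂)) := by field_simp; ring
    _ ≤ 2 / τ₁ * ‖b - b'‖ * ((‖b‖ + τ₁) * (‖b'‖ + τ₁) * (‖x‖ + τ₂)) := by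
        gcongr
        linarith

namespace MixingParam

variable {d₁ d₂ : ℕ}

theorem measurable_regression {τ₁ τ₂ : ℝ}
    {h : EuclideanSpace ℝ (Fin d₁) → EuclideanSpace ℝ (Fin d₂) → ℝ}
    {Θ : Set (ℝ × EuclideanSpace ℝ (Fin d₁) × EuclideanSpace ℝ (Fin d₂))}
    (h_meas : ∀ θ ∈ Θ, Measurable fun x => h x θ.2.2) {G : MixingParam d₁ d₂}
    (hG : G.ParamsIn Θ) : Measurable (G.regression τ₁ τ₂ h) := by
  have h1 : ∀ i, Measurable fun x => h x (G.η i) := fun i => h_meas _ (hG i)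
  unfold regression softmax perturbedCosine
  fun_prop

theorem abs_regression_le {τ₁ τ₂ M : ℝ} (hM : 0 ≤ M)
    {h : EuclideanSpace ℝ (Fin d₁) → EuclideanSpace ℝ (Fin d₂) → ℝ} (G : MixingParam d₁ d₂)
    {x : EuclideanSpace ℝ (Fin d₁)} (hx : ∀ i, |h x (G.η i)| ≤ M) :
    |G.regression τ₁ τ₂ h x| ≤ M := by
  unfold regression
  refine (Finset.abs_sum_le_sum_abs _ _).trans ?_
  calc _ ≤ ∑ i, softmax (fun j => perturbedCosine τ₁ τ₂ (G.β₁ j) x + G.β₀ j) i * M := by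
        refine Finset.sum_le_sum fun i _ => ?_
        rw [abs_mul, abs_of_nonneg (softmax_nonneg _ _)]
        exact mul_le_mul_of_nonneg_left (hx i) (softmax_nonneg _ _)
    _ ≤ 1 * M := by
        rw [← Finset.sum_mul]
        exact mul_le_mul_of_nonneg_right (sum_softmax_le_one _) hM
    _ = M := one_mul M

/-- The mixing measure with `k` atoms given by a vector of parameters. -/
noncomputable def ofVector {k : ℕ}
    (p : Fin k → ℝ × EuclideanSpace ℝ (Fin d₁) × EuclideanSpace ℝ (Fin d₂)) :
    MixingParam d₁ d₂ where
  size := k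
  β₀ i := (p i).1
  β₁ i := (p i).2.1
  η i := (p i).2.2

/-- In each term the change of weight is paid by the bound `M` and the change of expert by `L`. Both
errors carry the factor `softmax w i`, which sums to at most one. -/
theorem abs_regression_ofVector_sub_le {τ₁ τ₂ M ρ : ℝ} {L : ℝ≥0} (hτ₁ : 0 < τ₁) (hτ₂ : 0 < τ₂)
    (hM : 0 ≤ M) {h : EuclideanSpace ℝ (Fin d₁) → EuclideanSpace ℝ (Fin d₂) → ℝ} {k : ℕ}
    {p q : Fin k → ℝ × EuclideanSpace ℝ (Fin d₁) × EuclideanSpace ℝ (Fin d₂)}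
    {x : EuclideanSpace ℝ (Fin d₁)} {s : Set (EuclideanSpace ℝ (Fin d₂))}
    (hL : LipschitzOnWith L (h x) s) (hp : ∀ i, (p i).2.2 ∈ s) (hq : ∀ i, (q i).2.2 ∈ s)
    (hb : ∀ i, |h x (p i).2.2| ≤ M) (hρ : (2 / τ₁ + 1) * ρ ≤ 1 / 2) (hpq : dist p q ≤ ρ) :
    |(ofVector p).regression τ₁ τ₂ h x - (ofVector q).regression τ₁ τ₂ h x| ≤
      (8 * (2 / τ₁ + 1) * M + L) * ρ := by
  have hρ0 : 0 ≤ ρ := dist_nonneg.trans hpq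
  have hd : ∀ i, dist (p i) (q i) ≤ ρ := fun i => (dist_le_pi_dist p q i).trans hpq
  have hd0 : ∀ i, |(p i).1 - (q i).1| ≤ ρ := fun i => (le_max_left _ _).trans (hd i)
  have hd1 : ∀ i, ‖(p i).2.1 - (q i).2.1‖ ≤ ρ := fun i => by
    rw [← dist_eq_norm]
    exact ((le_max_left _ _).trans (le_max_right _ _)).trans (hd i)
  have hd2 : ∀ i, dist (p i).2.2 (q i).2.2 ≤ ρ := fun i =>
    ((le_max_right _ _).trans (le_max_right _ _)).trans (hd i)
  set v : Fin k → ℝ := fun j => perturbedCosine τ₁ τ₂ (p j).2.1 x + (p j).1 with hv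
  set w : Fin k → ℝ := fun j => perturbedCosine τ₁ τ₂ (q j).2.1 x + (q j).1 with hw
  have hvw : ∀ i, |v i - w i| ≤ (2 / τ₁ + 1) * ρ := by
    intro i
    have h1 := abs_perturbedCosine_sub_le hτ₁ hτ₂ (p i).2.1 (q i).2.1 x
    have h2 : 2 / τ₁ * ‖(p i).2.1 - (q i).2.1‖ ≤ 2 / τ₁ * ρ := by gcongr; exact hd1 i
    have h3 : v i - w i = (perturbedCosine τ₁ τ₂ (p i).2.1 x - perturbedCosine τ₁ τ₂ (q i).2.1 x)
        + ((p i).1 - (q i).1) := by simp only [hv, hw]; ring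
    rw [h3]
    refine (abs_add_le _ _).trans ?_
    linarith [hd0 i]
  have hs := fun i => abs_softmax_sub_le (by positivity) hρ hvw i
  have hterm : ∀ i, |softmax v i * h x (p i).2.2 - softmax w i * h x (q i).2.2| ≤
      softmax w i * ((8 * (2 / τ₁ + 1) * M + L) * ρ) := by
    intro i
    have hw0 := softmax_nonneg w i
    have h1 : |h x (p i).2.2 - h x (q i).2.2| ≤ L * ρ := by
      rw [← Real.dist_eq]
      exact (hL.dist_le_mul _ (hp i) _ (hq i)).trans (by gcongr; exact hd2 i)
    have h2 : softmax v i * h x (p i).2.2 - softmax w i * h x (q i).2.2 =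
        (softmax v i - softmax w i) * h x (p i).2.2 +
          softmax w i * (h x (p i).2.2 - h x (q i).2.2) := by ring
    rw [h2]
    calc _ ≤ |softmax v i - softmax w i| * |h x (p i).2.2| +
          softmax w i * |h x (p i).2.2 - h x (q i).2.2| := by
          refine (abs_add_le _ _).trans ?_
          rw [abs_mul, abs_mul, abs_of_nonneg hw0]
      _ ≤ 8 * ((2 / τ₁ + 1) * ρ) * softmax w i * M + softmax w i * (L * ρ) := by
          gcongr
          · exact hs i
          · exact hb i
      _ = _ := by ring
  have hreg : (ofVector p).regression τ₁ τ₂ h x - (ofVector q).regression τ₁ τ₂ h x =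
      ∑ i, (softmax v i * h x (p i).2.2 - softmax w i * h x (q i).2.2) := by
    rw [Finset.sum_sub_distrib]
    rfl
  rw [hreg]
  refine (Finset.abs_sum_le_sum_abs _ _).trans ((Finset.sum_le_sum fun i _ => hterm i).trans ?_)
  rw [← Finset.sum_mul]
  exact mul_le_of_le_one_left (by positivity) (sum_softmax_le_one w)

end MixingParam

/-! ### Polynomial covers of the regression classes -/

/-- `f` indexes a class of functions over `𝓒` whose uniform covering numbers on `𝒳` grow at most
polynomially in the inverse radius. -/
def HasPolynomialCover {ι E : Type*} (f : ι → E → ℝ) (𝓒 : Set ι) (𝒳 : Set E) : Prop :=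
  ∃ K D : ℕ, ∀ n : ℕ, 1 ≤ n → ∃ T : Finset ι, ↑T ⊆ 𝓒 ∧ T.card ≤ K * n ^ D ∧
    ∀ G ∈ 𝓒, ∃ G' ∈ T, ∀ x ∈ 𝒳, |f G x - f G' x| ≤ 1 / (n : ℝ)

theorem HasPolynomialCover.empty {ι E : Type*} (f : ι → E → ℝ) (𝒳 : Set E) :
    HasPolynomialCover f ∅ 𝒳 :=
  ⟨0, 0, fun _ _ => ⟨∅, by simp⟩⟩

theorem HasPolynomialCover.union {ι E : Type*} {f : ι → E → ℝ} {𝓒 𝓓 : Set ι} {𝒳 : Set E}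
    (h𝓒 : HasPolynomialCover f 𝓒 𝒳) (h𝓓 : HasPolynomialCover f 𝓓 𝒳) :
    HasPolynomialCover f (𝓒 ∪ 𝓓) 𝒳 := by
  classical
  obtain ⟨K, D, H⟩ := h𝓒
  obtain ⟨K', D', H'⟩ := h𝓓
  refine ⟨K + K', D + D', fun n hn => ?_⟩
  obtain ⟨T, hT, hTc, hTn⟩ := H n hn
  obtain ⟨T', hT', hTc', hTn'⟩ := H' n hn
  refine ⟨T ∪ T', ?_, ?_, ?_⟩
  · rw [Finset.coe_union]
    exact Set.union_subset_union hT hT'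
  · have h1 : n ^ D ≤ n ^ (D + D') := Nat.pow_le_pow_right hn (by omega)
    have h2 : n ^ D' ≤ n ^ (D + D') := Nat.pow_le_pow_right hn (by omega)
    calc (T ∪ T').card ≤ T.card + T'.card := Finset.card_union_le _ _
      _ ≤ K * n ^ (D + D') + K' * n ^ (D + D') := by
          refine Nat.add_le_add (hTc.trans ?_) (hTc'.trans ?_) <;> gcongr
      _ = _ := by ring
  · rintro G (hG | hG)
    · obtain ⟨G', hG', h⟩ := hTn G hG
      exact ⟨G', Finset.mem_union_left _ hG', h⟩
    · obtain ⟨G', hG', h⟩ := hTn' G hG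
      exact ⟨G', Finset.mem_union_right _ hG', h⟩

theorem hasPolynomialCover_exactClass {d₁ d₂ : ℕ}
    {Θ : Set (ℝ × EuclideanSpace ℝ (Fin d₁) × EuclideanSpace ℝ (Fin d₂))}
    (hΘ : Bornology.IsBounded Θ) {𝒳 : Set (EuclideanSpace ℝ (Fin d₁))}
    {τ₁ τ₂ : ℝ} (hτ₁ : 0 < τ₁) (hτ₂ : 0 < τ₂)
    {h : EuclideanSpace ℝ (Fin d₁) → EuclideanSpace ℝ (Fin d₂) → ℝ} {L : ℝ≥0} {M : ℝ}
    (hM : 0 ≤ M) (h_lip : ∀ x ∈ 𝒳, LipschitzOnWith L (h x) ((fun θ => θ.2.2) '' Θ))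
    (h_bdd : ∀ x ∈ 𝒳, ∀ θ ∈ Θ, |h x θ.2.2| ≤ M) (k : ℕ) :
    HasPolynomialCover (fun G : MixingParam d₁ d₂ => G.regression τ₁ τ₂ h)
      (exactClass k Θ) 𝒳 := by
  classical
  set S : Set (Fin k → ℝ × EuclideanSpace ℝ (Fin d₁) × EuclideanSpace ℝ (Fin d₂)) :=
    Set.univ.pi fun _ => Θ with hS
  obtain ⟨K, D, H⟩ := exists_finset_cover_card_le_pow (S := S) (Bornology.IsBounded.pi fun _ => hΘ)
  -- At parameter radius `1 / (a n)`, the first summand keeps the logits within `1 / 2` and the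
  -- second brings the regression error below `1 / n`.
  obtain ⟨a, ha⟩ := exists_nat_ge (2 * (2 / τ₁ + 1) + (8 * (2 / τ₁ + 1) * M + L))
  have hτ : 0 < 2 / τ₁ := by positivity
  have hA : 0 ≤ 8 * (2 / τ₁ + 1) * M + L := by positivity
  have ha0 : (0 : ℝ) < a := by linarith
  have ha1 : 1 ≤ a := by exact_mod_cast ha0
  refine ⟨K * a ^ D, D, fun n hn => ?_⟩
  have hn0 : (1 : ℝ) ≤ n := by exact_mod_cast hn
  obtain ⟨T, hTS, hTc, hT⟩ := H (a * n) (Nat.mul_pos ha1 hn)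
  refine ⟨T.image MixingParam.ofVector, ?_, ?_, ?_⟩
  · intro G hG
    obtain ⟨p, hp, rfl⟩ := by simpa using hG
    exact ⟨rfl, fun i => hTS hp i (Set.mem_univ i)⟩
  · refine Finset.card_image_le.trans (hTc.trans_eq ?_)
    rw [mul_pow, mul_assoc]
  · rintro ⟨m, β₀, β₁, η⟩ ⟨hk, hG⟩
    obtain rfl : m = k := hk
    obtain ⟨q, hq, hpq⟩ := hT (fun i => (β₀ i, β₁ i, η i)) (fun i _ => hG i)
    refine ⟨_, Finset.mem_image_of_mem _ hq, fun x hx => ?_⟩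
    push_cast at hpq
    have h1 := MixingParam.abs_regression_ofVector_sub_le hτ₁ hτ₂ hM (h_lip x hx)
      (fun i => ⟨_, hG i, rfl⟩) (fun i => ⟨_, hTS hq i (Set.mem_univ i), rfl⟩)
      (fun i => h_bdd x hx _ (hG i)) ?_ hpq
    · refine h1.trans ?_
      rw [mul_one_div, div_le_div_iff₀ (by positivity) (by positivity), one_mul]
      gcongr
      linarith
    · rw [mul_one_div, div_le_div_iff₀ (by positivity) (by positivity), one_mul]
      nlinarith

/-- The class is the finite union of the exact classes of sizes `1, …, k`. -/
theorem hasPolynomialCover_overClass {d₁ d₂ : ℕ}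
    {Θ : Set (ℝ × EuclideanSpace ℝ (Fin d₁) × EuclideanSpace ℝ (Fin d₂))}
    {𝒳 : Set (EuclideanSpace ℝ (Fin d₁))} {f : MixingParam d₁ d₂ → EuclideanSpace ℝ (Fin d₁) → ℝ}
    (hf : ∀ k, HasPolynomialCover f (exactClass k Θ) 𝒳) (k : ℕ) :
    HasPolynomialCover f (overClass k Θ) 𝒳 := by
  induction k with
  | zero =>
    convert HasPolynomialCover.empty f 𝒳
    ext G
    simp only [overClass, Set.mem_ofPred_eq, Set.mem_empty_iff_false, iff_false]
    omega
  | succ k ih =>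
    convert ih.union (hf (k + 1))
    ext G
    simp only [overClass, exactClass, Set.mem_ofPred_eq, Set.mem_union]
    constructor
    · rintro ⟨h1, h2, h3⟩
      rcases Nat.lt_or_ge k G.size with h4 | h4
      · exact Or.inr ⟨by omega, h3⟩
      · exact Or.inl ⟨h1, h4, h3⟩
    · rintro (⟨h1, h2, h3⟩ | ⟨h1, h3⟩)
      · exact ⟨h1, by omega, h3⟩
      · exact ⟨by omega, by omega, h3⟩

/-! ### Exponential moments and tail bounds -/

theorem exp_neg_le_one_sub_half {u : ℝ} (h0 : 0 ≤ u) (h1 : u ≤ 1) :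
    Real.exp (-u) ≤ 1 - u / 2 := by
  have h2 : 1 + u ≤ Real.exp u := by linarith [Real.add_one_le_exp u]
  rw [Real.exp_neg]
  calc (Real.exp u)⁻¹ ≤ (1 + u)⁻¹ := by gcongr
    _ ≤ 1 - u / 2 := by
      rw [inv_le_iff_one_le_mul₀ (by linarith)]
      nlinarith

section OneSample

variable {E : Type*} [MeasurableSpace E] {μ : Measure E} {D : E → ℝ} {B l : ℝ} {σ : ℝ≥0}

theorem integral_exp_mul_gaussianReal_section (d : ℝ) :
    ∫ e, Real.exp (l * (2 * e * d - d ^ 2)) ∂gaussianReal 0 (σ ^ 2) =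
      Real.exp (-(l * (1 - 2 * l * σ ^ 2) * d ^ 2)) := by
  have h1 : ∀ e, Real.exp (l * (2 * e * d - d ^ 2)) =
      Real.exp (-(l * d ^ 2)) * Real.exp (2 * l * d * e) := by
    intro e
    rw [← Real.exp_add]
    congr 1
    ring
  have h2 := congrFun (mgf_id_gaussianReal (μ := 0) (v := σ ^ 2)) (2 * l * d)
  simp only [mgf, id] at h2
  simp_rw [h1]
  rw [integral_const_mul, h2, ← Real.exp_add]
  congr 1
  push_cast
  ring

/-- Integrating out the Gaussian noise first leaves a function of `x` bounded by one. -/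
theorem integrable_exp_excessLoss [IsProbabilityMeasure μ] (hD : Measurable D) (hl : 0 ≤ l)
    (hlσ : 4 * l * σ ^ 2 ≤ 1) :
    Integrable (fun z : E × ℝ => Real.exp (l * (2 * z.2 * D z.1 - D z.1 ^ 2)))
      (μ.prod (gaussianReal 0 (σ ^ 2))) := by
  rw [integrable_prod_iff (by
    refine Measurable.aestronglyMeasurable ?_
    fun_prop)]
  refine ⟨Eventually.of_forall fun x => ?_, ?_⟩
  · have h1 : ∀ e, Real.exp (l * (2 * e * D x - D x ^ 2)) =
        Real.exp (-(l * D x ^ 2)) * Real.exp (2 * l * D x * e) := by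
      intro e
      rw [← Real.exp_add]
      congr 1
      ring
    simp_rw [h1]
    exact (integrable_exp_mul_gaussianReal _).const_mul _
  · simp only [Real.norm_eq_abs, Real.abs_exp, integral_exp_mul_gaussianReal_section]
    refine Integrable.of_bound (C := 1) ?_ (Eventually.of_forall fun x => ?_)
    · refine Measurable.aestronglyMeasurable ?_
      fun_prop
    · rw [Real.norm_eq_abs, Real.abs_exp, Real.exp_le_one_iff, neg_nonpos]
      have : 0 ≤ 1 - 2 * l * σ ^ 2 := by linarith
      positivity

theorem integrable_sq_of_ae_bound [IsFiniteMeasure μ] (hD : Measurable D)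
    (hB : ∀ᵐ x ∂μ, |D x| ≤ B) : Integrable (fun x => D x ^ 2) μ := by
  refine Integrable.of_bound (C := B ^ 2) (hD.pow_const 2).aestronglyMeasurable ?_
  filter_upwards [hB] with x hx
  rw [Real.norm_eq_abs, abs_pow]
  gcongr

/-- The noise uses up at most half of the exponent `-l d²`. The bound on `l * B ^ 2` puts the
remaining `l d² / 2` in `[0, 1]`, where the exponential is dominated by an affine function of `d²`
that can be integrated over `x`. -/
theorem integral_exp_excessLoss_le [IsProbabilityMeasure μ] (hD : Measurable D)
    (hB : ∀ᵐ x ∂μ, |D x| ≤ B) (hl : 0 ≤ l) (hlσ : 4 * l * σ ^ 2 ≤ 1) (hlB : l * B ^ 2 ≤ 2) :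
    ∫ z : E × ℝ, Real.exp (l * (2 * z.2 * D z.1 - D z.1 ^ 2)) ∂μ.prod (gaussianReal 0 (σ ^ 2)) ≤
      Real.exp (-(l / 4 * ∫ x, D x ^ 2 ∂μ)) := by
  have hint := integrable_exp_excessLoss (μ := μ) hD hl hlσ
  have hsq := integrable_sq_of_ae_bound hD hB
  rw [integral_prod _ hint]
  calc ∫ x, ∫ e, Real.exp (l * (2 * e * D x - D x ^ 2)) ∂gaussianReal 0 (σ ^ 2) ∂μ
      ≤ ∫ x, (1 - l / 4 * D x ^ 2) ∂μ := by
        refine integral_mono_ae hint.integral_prod_left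
          ((integrable_const _).sub (hsq.const_mul _)) ?_
        filter_upwards [hB] with x hx
        simp only [integral_exp_mul_gaussianReal_section]
        have h1 : D x ^ 2 ≤ B ^ 2 := by
          rw [← sq_abs (D x)]
          gcongr
        have h2 : 0 ≤ l * D x ^ 2 := by positivity
        have h3 : l * D x ^ 2 ≤ l * B ^ 2 := by gcongr
        have h4 := exp_neg_le_one_sub_half (u := l * D x ^ 2 / 2) (by linarith) (by linarith)
        have h5 : Real.exp (-(l * (1 - 2 * l * σ ^ 2) * D x ^ 2)) ≤
            Real.exp (-(l * D x ^ 2 / 2)) := by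
          refine Real.exp_le_exp.2 ?_
          nlinarith
        linarith
    _ = 1 - l / 4 * ∫ x, D x ^ 2 ∂μ := by
        rw [integral_sub (integrable_const _) (hsq.const_mul _), integral_const_mul]
        simp
    _ ≤ _ := by
        linarith [Real.add_one_le_exp (-(l / 4 * ∫ x, D x ^ 2 ∂μ))]

end OneSample

section Sample

variable {E : Type*} [MeasurableSpace E] {μ : Measure E} [IsProbabilityMeasure μ]
  {Ω : Type*} [MeasurableSpace Ω] {P : Measure Ω} {σ : ℝ≥0}
  {X : ℕ → Ω → E} {ε : ℕ → Ω → ℝ}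

/-- Lower tail bound for the empirical excess loss of a regression function at distance `D` from
the true one. -/
theorem measureReal_sum_excessLoss_le [IsProbabilityMeasure P] {D : E → ℝ} {B l : ℝ}
    (h_indep : iIndepFun (fun i ω => (X i ω, ε i ω)) P)
    (h_law : ∀ i, HasLaw (fun ω => (X i ω, ε i ω)) (μ.prod (gaussianReal 0 (σ ^ 2))) P)
    (hD : Measurable D) (hB : ∀ᵐ x ∂μ, |D x| ≤ B) (hl : 0 ≤ l) (hlσ : 4 * l * σ ^ 2 ≤ 1)
    (hlB : l * B ^ 2 ≤ 2) (n : ℕ) (t : ℝ) :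
    P.real {ω | ∑ i ∈ Finset.range n, (D (X i ω) ^ 2 - 2 * ε i ω * D (X i ω)) ≤ t} ≤
      Real.exp (l * t - n * (l / 4 * ∫ x, D x ^ 2 ∂μ)) := by
  set ψ : E × ℝ → ℝ := fun z => 2 * z.2 * D z.1 - D z.1 ^ 2 with hψ
  have hψm : Measurable ψ := by fun_prop
  set Z : ℕ → Ω → ℝ := fun i ω => ψ (X i ω, ε i ω) with hZ
  have hZm : ∀ i, AEMeasurable (Z i) P := fun i =>
    hψm.comp_aemeasurable (h_law i).aemeasurable
  have hZi : iIndepFun Z P := h_indep.comp (fun _ => ψ) fun _ => hψm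
  have hexp : AEStronglyMeasurable (fun z => Real.exp (l * ψ z))
      (μ.prod (gaussianReal 0 (σ ^ 2))) :=
    Measurable.aestronglyMeasurable (by fun_prop)
  have hmgf_eq : ∀ i, mgf (Z i) P l =
      ∫ z, Real.exp (l * ψ z) ∂μ.prod (gaussianReal 0 (σ ^ 2)) := fun i =>
    (h_law i).integral_comp hexp
  have hint : ∀ i, Integrable (fun ω => Real.exp (l * Z i ω)) P := by
    intro i
    have h1 := integrable_exp_excessLoss (μ := μ) hD hl hlσ
    rw [← (h_law i).map_eq] at h1
    exact h1.comp_aemeasurable (h_law i).aemeasurable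
  have hsum : mgf (∑ i ∈ Finset.range n, Z i) P l = ∏ i ∈ Finset.range n, mgf (Z i) P l :=
    hZi.mgf_sum₀ hZm _
  have hsum_int : Integrable (fun ω => Real.exp (l * (∑ i ∈ Finset.range n, Z i) ω)) P := by
    rw [← mgf_pos_iff, hsum]
    exact Finset.prod_pos fun i _ => mgf_pos (hint i)
  have hle : mgf (∑ i ∈ Finset.range n, Z i) P l ≤
      Real.exp (-(l / 4 * ∫ x, D x ^ 2 ∂μ)) ^ n := by
    rw [hsum]
    have h1 : ∀ i, mgf (Z i) P l ≤ Real.exp (-(l / 4 * ∫ x, D x ^ 2 ∂μ)) := fun i => by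
      rw [hmgf_eq]
      exact integral_exp_excessLoss_le hD hB hl hlσ hlB
    exact (Finset.prod_le_prod (fun i _ => mgf_nonneg) fun i _ => h1 i).trans_eq (by simp)
  have hset : {ω | ∑ i ∈ Finset.range n, (D (X i ω) ^ 2 - 2 * ε i ω * D (X i ω)) ≤ t} =
      {ω | -t ≤ (∑ i ∈ Finset.range n, Z i) ω} := by
    ext ω
    simp only [Set.mem_ofPred_eq, Finset.sum_apply, hZ, hψ]
    rw [neg_le, ← Finset.sum_neg_distrib]
    simp only [neg_sub]
  rw [hset]
  refine (measure_ge_le_exp_mul_mgf _ hl hsum_int).trans ?_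
  calc _ ≤ Real.exp (-l * -t) * Real.exp (-(l / 4 * ∫ x, D x ^ 2 ∂μ)) ^ n := by gcongr
    _ = _ := by
      rw [← Real.exp_nat_mul, ← Real.exp_add]
      congr 1
      ring

/-- Markov's inequality suffices: the noise only multiplies a discretization error of order `1 / n`.
-/
theorem measureReal_sum_abs_noise_ge_le
    (h_law : ∀ i, HasLaw (fun ω => (X i ω, ε i ω)) (μ.prod (gaussianReal 0 (σ ^ 2))) P)
    {n : ℕ} (hn : 1 ≤ n) {T : ℝ} (hT : 0 < T) :
    P.real {ω | n * T ≤ ∑ i ∈ Finset.range n, |ε i ω|} ≤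
      (∫ e, |e| ∂gaussianReal 0 (σ ^ 2)) / T := by
  have hn0 : (0 : ℝ) < n := by exact_mod_cast hn
  have hε : ∀ i, HasLaw (ε i) (gaussianReal 0 (σ ^ 2)) P := fun i => by
    have h1 : HasLaw (Prod.snd : E × ℝ → ℝ) (gaussianReal 0 (σ ^ 2))
        (μ.prod (gaussianReal 0 (σ ^ 2))) := ⟨by fun_prop, by simp⟩
    exact h1.fun_comp (h_law i)
  have hg : Integrable (fun e : ℝ => |e|) (gaussianReal 0 (σ ^ 2)) :=
    ((memLp_id_gaussianReal 1).integrable le_rfl).abs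
  have hi : ∀ i, Integrable (fun ω => |ε i ω|) P := fun i => by
    have h1 := hg
    rw [← (hε i).map_eq] at h1
    exact h1.comp_aemeasurable (hε i).aemeasurable
  have he : ∀ i, ∫ ω, |ε i ω| ∂P = ∫ e, |e| ∂gaussianReal 0 (σ ^ 2) := fun i =>
    (hε i).integral_comp hg.aestronglyMeasurable
  have h1 := mul_meas_ge_le_integral_of_nonneg (μ := P)
    (f := fun ω => ∑ i ∈ Finset.range n, |ε i ω|)
    (Eventually.of_forall fun ω => Finset.sum_nonneg fun i _ => abs_nonneg _)
    (integrable_finsetSum _ fun i _ => hi i) (n * T)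
  rw [integral_finsetSum _ fun i _ => hi i, Finset.sum_congr rfl fun i _ => he i,
    Finset.sum_const, Finset.card_range, nsmul_eq_mul] at h1
  rw [le_div_iff₀ hT]
  rw [mul_assoc] at h1
  have h2 := le_of_mul_le_mul_left h1 hn0
  linarith

end Sample

/-! ### Rate of convergence of least squares -/

theorem eLpNorm_two_eq_ofReal_sqrt {E : Type*} [MeasurableSpace E] {μ : Measure E}
    {D : E → ℝ} (hD : Measurable D) (hsq : Integrable (fun x => D x ^ 2) μ) :
    eLpNorm D 2 μ = ENNReal.ofReal (Real.sqrt (∫ x, D x ^ 2 ∂μ)) := by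
  have h : MemLp D 2 μ := (memLp_two_iff_integrable_sq hD.aestronglyMeasurable).2 hsq
  rw [h.eLpNorm_eq_integral_rpow_norm (by norm_num) (by norm_num), Real.sqrt_eq_rpow]
  simp

/-- On every sample, the excess loss of a function which is at uniform distance `r` from a
least squares estimator is small. -/
theorem sum_excessLoss_le_of_close {n : ℕ} {d d' e : ℕ → ℝ} {M r : ℝ} (hr : 0 ≤ r)
    (hd : ∀ i, |d i| ≤ 2 * M) (hd' : ∀ i, |d' i| ≤ 2 * M) (hdd' : ∀ i, |d i - d' i| ≤ r)
    (h0 : ∑ i ∈ Finset.range n, (d i ^ 2 - 2 * e i * d i) ≤ 0) :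
    ∑ i ∈ Finset.range n, (d' i ^ 2 - 2 * e i * d' i) ≤
      n * (4 * M * r) + 2 * r * ∑ i ∈ Finset.range n, |e i| := by
  have h1 : ∀ i, d' i ^ 2 - 2 * e i * d' i ≤
      (d i ^ 2 - 2 * e i * d i) + (4 * M * r + 2 * r * |e i|) := by
    intro i
    have h2 : |d' i + d i| ≤ 4 * M := (abs_add_le _ _).trans (by linarith [hd i, hd' i])
    have h3 : (d' i ^ 2 - 2 * e i * d' i) - (d i ^ 2 - 2 * e i * d i) =
        -(d i - d' i) * (d' i + d i) + 2 * (d i - d' i) * e i := by ring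
    have h4 : |d i - d' i| * |d' i + d i| ≤ r * (4 * M) :=
      mul_le_mul (hdd' i) h2 (abs_nonneg _) hr
    have h5 : |d i - d' i| * |e i| ≤ r * |e i| := by gcongr; exact hdd' i
    have h6 := neg_abs_le ((d i - d' i) * (d' i + d i))
    have h7 := le_abs_self ((d i - d' i) * e i)
    rw [abs_mul] at h6 h7
    linarith
  refine (Finset.sum_le_sum fun i _ => h1 i).trans ?_
  rw [Finset.sum_add_distrib, Finset.sum_add_distrib, Finset.sum_const, Finset.card_range,
    nsmul_eq_mul, ← Finset.mul_sum]
  linarith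

theorem integral_sq_le_of_close {E : Type*} [MeasurableSpace E] {μ : Measure E}
    [IsProbabilityMeasure μ] {D D' : E → ℝ} {r : ℝ}
    (hD : Integrable (fun x => D x ^ 2) μ) (hD' : Integrable (fun x => D' x ^ 2) μ)
    (h : ∀ᵐ x ∂μ, |D x - D' x| ≤ r) :
    ∫ x, D x ^ 2 ∂μ ≤ 2 * ∫ x, D' x ^ 2 ∂μ + 2 * r ^ 2 := by
  have h1 : ∫ x, D x ^ 2 ∂μ ≤ ∫ x, (2 * D' x ^ 2 + 2 * r ^ 2) ∂μ := by
    refine integral_mono_ae hD ((hD'.const_mul 2).add (integrable_const _)) ?_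
    filter_upwards [h] with x hx
    have h2 : (D x - D' x) ^ 2 ≤ r ^ 2 := by
      rw [← sq_abs (D x - D' x)]
      gcongr
    nlinarith [sq_nonneg (D x - 2 * D' x)]
  rw [integral_add (hD'.const_mul 2) (integrable_const _), integral_const_mul] at h1
  simpa using h1

/-- Least squares estimators over a bounded class of functions with polynomial uniform covering
numbers converge at the rate `√(log n / n)` in well-specified Gaussian regression. -/
theorem isBigOInProbability_leastSquares {ι E : Type*} [MeasurableSpace E] {μ : Measure E}
    [IsProbabilityMeasure μ] {𝒳 : Set E} (hμ : ∀ᵐ x ∂μ, x ∈ 𝒳) {f : ι → E → ℝ} {𝓒 : Set ι}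
    {M : ℝ} (hf : ∀ G ∈ 𝓒, Measurable (f G))
    (hfM : ∀ G ∈ 𝓒, ∀ x ∈ 𝒳, |f G x| ≤ M) (hcover : HasPolynomialCover f 𝓒 𝒳)
    {G₀ : ι} (hG₀ : G₀ ∈ 𝓒)
    {Ω : Type*} [MeasurableSpace Ω] {P : Measure Ω} [IsProbabilityMeasure P] {σ : ℝ≥0}
    {X : ℕ → Ω → E} {ε : ℕ → Ω → ℝ} {Y : ℕ → Ω → ℝ}
    (h_indep : iIndepFun (fun i ω => (X i ω, ε i ω)) P)
    (h_law : ∀ i, HasLaw (fun ω => (X i ω, ε i ω)) (μ.prod (gaussianReal 0 (σ ^ 2))) P)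
    (hY : ∀ i ω, Y i ω = f G₀ (X i ω) + ε i ω) {Gt : ℕ → Ω → ι}
    (hGt : ∀ n, ∀ᵐ ω ∂P, Gt n ω ∈ 𝓒 ∧
      IsMinOn (fun G => ∑ i ∈ Finset.range n, (Y i ω - f G (X i ω)) ^ 2) 𝓒 (Gt n ω)) :
    IsBigOInProbability P (fun n ω => eLpNorm (f (Gt n ω) - f G₀) 2 μ)
      (fun n => Real.sqrt (Real.log n / n)) := by
  classical
  intro δ hδ
  obtain ⟨K, D, hKD⟩ := hcover
  set m := ∫ e, |e| ∂gaussianReal 0 (σ ^ 2) with hm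
  have hm0 : 0 ≤ m := integral_nonneg fun e => abs_nonneg e
  -- Makes the Markov bound `m / T` at most `δ / 2`; the `+ 1` keeps `T` positive when `m = 0`.
  set T : ℝ := (2 * m + 1) / δ with hT
  have hT0 : 0 < T := by positivity
  have hmT : m / T ≤ δ / 2 := by
    rw [hT, div_div_eq_mul_div, div_le_div_iff₀ (by positivity) (by norm_num)]
    nlinarith
  obtain ⟨l, hl, hlσ, hlM⟩ : ∃ l : ℝ, 0 < l ∧ 4 * l * σ ^ 2 ≤ 1 ∧ l * (2 * M) ^ 2 ≤ 2 := by
    have h0 : (0 : ℝ) < 4 * σ ^ 2 + 2 * M ^ 2 + 1 := by positivity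
    refine ⟨1 / (4 * σ ^ 2 + 2 * M ^ 2 + 1), by positivity, ?_, ?_⟩
    · rw [mul_one_div, div_mul_eq_mul_div, div_le_one h0]
      linarith [sq_nonneg M]
    · rw [div_mul_eq_mul_div, div_le_iff₀ h0]
      nlinarith [sq_nonneg (σ : ℝ)]
  set t : ℝ := 4 * M + 2 * T with ht
  -- `16` is `4` from the rate `l / 4` of the tail bound times `4` from passing to a net point. The
  -- summand `2` absorbs the squared net radius and gives `C ≤ C ^ 2`.
  set C : ℝ := 2 + 16 * (D + 1) / l with hC
  have hC2 : 2 ≤ C := by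
    have : 0 ≤ 16 * (D + 1) / l := by positivity
    linarith
  have hCl : 16 * (D + 1) ≤ l * C ^ 2 := by
    have h1 : 16 * (D + 1) / l ≤ C ^ 2 := by nlinarith
    rw [div_le_iff₀ hl] at h1
    linarith
  refine ⟨C, by linarith, ?_⟩
  have hev : ∀ᶠ n : ℕ in atTop, K * Real.exp (l * t) / (n : ℝ) ≤ δ / 2 :=
    (tendsto_const_div_atTop_nhds_zero_nat _).eventually_le_const (by positivity)
  filter_upwards [hev, eventually_ge_atTop 3] with n hn hn3
  have hn0 : (3 : ℝ) ≤ n := by exact_mod_cast hn3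
  have hn1 : (0 : ℝ) < n := by linarith
  have hlog : 1 ≤ Real.log n := by
    rw [Real.le_log_iff_exp_le hn1]
    linarith [Real.exp_one_lt_d9]
  obtain ⟨N, hN𝓒, hNcard, hN⟩ := hKD n (by omega)
  have hsq : ∀ G ∈ 𝓒, Integrable (fun x => (f G x - f G₀ x) ^ 2) μ := fun G hG =>
    integrable_sq_of_ae_bound (B := 2 * M) ((hf G hG).sub (hf G₀ hG₀))
      (hμ.mono fun x hx => (abs_sub _ _).trans (by linarith [hfM G hG x hx, hfM G₀ hG₀ x hx]))
  set V : ι → ℝ := fun G => ∫ x, (f G x - f G₀ x) ^ 2 ∂μ with hV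
  set A : Set Ω := {ω | n * T ≤ ∑ i ∈ Finset.range n, |ε i ω|} with hA
  set S : ι → Set Ω := fun G => {ω | ∑ i ∈ Finset.range n,
    ((f G (X i ω) - f G₀ (X i ω)) ^ 2 - 2 * ε i ω * (f G (X i ω) - f G₀ (X i ω))) ≤ t} with hS
  -- A net point near a bad estimator keeps a quarter of its squared distance: half is lost in `(a +
  -- b)² ≤ 2 a² + 2 b²`, and `2 / n²` takes at most half of the rest.
  set N' : Finset ι := N.filter fun G => C ^ 2 * (Real.log n / n) / 4 ≤ V G with hN'
  have hX : ∀ᵐ ω ∂P, ∀ i, X i ω ∈ 𝒳 := by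
    rw [ae_all_iff]
    intro i
    have h1 : ∀ᵐ z ∂μ.prod (gaussianReal 0 (σ ^ 2)), z.1 ∈ 𝒳 :=
      Measure.quasiMeasurePreserving_fst.ae hμ
    rw [← (h_law i).map_eq] at h1
    exact ae_of_ae_map (h_law i).aemeasurable h1
  have hsub : {ω | ENNReal.ofReal (C * Real.sqrt (Real.log n / n)) <
      eLpNorm (f (Gt n ω) - f G₀) 2 μ} ≤ᵐ[P] (A ∪ ⋃ G ∈ N', S G : Set Ω) := by
    filter_upwards [hGt n, hX] with ω hω hXω hbig
    obtain ⟨hG, hmin⟩ := hω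
    set G := Gt n ω
    rw [Set.union_def]
    by_contra hcon
    have hcon' : ω ∉ A ∧ ω ∉ ⋃ G ∈ N', S G := not_or.1 hcon
    obtain ⟨hωA, hωS⟩ := hcon'
    have hωA' : ∑ i ∈ Finset.range n, |ε i ω| ≤ n * T := (not_le.1 hωA).le
    obtain ⟨G', hG'N, hGG'⟩ := hN G hG
    have hG' := hN𝓒 hG'N
    have hbig' : ENNReal.ofReal (C * Real.sqrt (Real.log n / n)) <
        ENNReal.ofReal (Real.sqrt (V G)) := by
      exact lt_of_lt_of_eq hbig
        (eLpNorm_two_eq_ofReal_sqrt ((hf G hG).sub (hf G₀ hG₀)) (hsq G hG))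
    have hVG : C ^ 2 * (Real.log n / n) < V G := by
      have h1 := ENNReal.lt_ofReal_iff_toReal_lt (by simp) |>.1 hbig'
      rw [ENNReal.toReal_ofReal (by positivity), Real.lt_sqrt (by positivity), mul_pow,
        Real.sq_sqrt (by positivity)] at h1
      exact h1
    have hVle : V G ≤ 2 * V G' + 2 * (1 / (n : ℝ)) ^ 2 := by
      refine integral_sq_le_of_close (hsq G hG) (hsq G' hG') (hμ.mono fun x hx => ?_)
      rw [sub_sub_sub_cancel_right]
      exact hGG' x hx
    have hrate : 2 * (1 / (n : ℝ)) ^ 2 ≤ C ^ 2 * (Real.log n / n) / 2 := by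
      have h1 : (1 / (n : ℝ)) ^ 2 ≤ Real.log n / n := by
        rw [div_pow, one_pow, div_le_div_iff₀ (by positivity) hn1]
        nlinarith
      have h2 : 4 * (Real.log n / n) ≤ C ^ 2 * (Real.log n / n) := by
        gcongr
        nlinarith
      linarith
    have hG'N' : G' ∈ N' := Finset.mem_filter.2 ⟨hG'N, by linarith⟩
    refine hωS (Set.mem_biUnion hG'N' ?_)
    have hclose := sum_excessLoss_le_of_close (n := n)
      (d := fun i => f G (X i ω) - f G₀ (X i ω)) (d' := fun i => f G' (X i ω) - f G₀ (X i ω))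
      (e := fun i => ε i ω) (M := M) (r := 1 / (n : ℝ)) (by positivity)
      (fun i => (abs_sub _ _).trans
        (by linarith [hfM G hG _ (hXω i), hfM G₀ hG₀ _ (hXω i)]))
      (fun i => (abs_sub _ _).trans
        (by linarith [hfM G' hG' _ (hXω i), hfM G₀ hG₀ _ (hXω i)]))
      (fun i => by
        rw [sub_sub_sub_cancel_right]
        exact hGG' _ (hXω i)) ?_
    · refine hclose.trans ?_
      have h1 : 2 * (1 / (n : ℝ)) * ∑ i ∈ Finset.range n, |ε i ω| ≤
          2 * (1 / (n : ℝ)) * (n * T) := by gcongr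
      have h2 : 2 * (1 / (n : ℝ)) * (n * T) = 2 * T := by field_simp
      have h3 : n * (4 * M * (1 / (n : ℝ))) = 4 * M := by field_simp
      linarith
    -- Basic inequality: the difference of the criteria at `G` and `G₀` is exactly the empirical
    -- excess loss.
    · have h1 := isMinOn_iff.1 hmin G₀ hG₀
      rw [← sub_nonpos, ← Finset.sum_sub_distrib] at h1
      refine (Finset.sum_congr rfl fun i _ => ?_).trans_le h1
      rw [hY]
      ring
  have hPA : P.real A ≤ δ / 2 :=
    (measureReal_sum_abs_noise_ge_le h_law (by omega) hT0).trans hmT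
  have hPS : ∀ G ∈ N', P.real (S G) ≤ Real.exp (l * t) / (n : ℝ) ^ (D + 1) := by
    intro G hG
    obtain ⟨hGN, hVG⟩ := Finset.mem_filter.1 hG
    have hG𝓒 := hN𝓒 hGN
    refine (measureReal_sum_excessLoss_le (B := 2 * M) h_indep h_law
      ((hf G hG𝓒).sub (hf G₀ hG₀)) (hμ.mono fun x hx => (abs_sub _ _).trans
        (by linarith [hfM G hG𝓒 x hx, hfM G₀ hG₀ x hx])) hl.le hlσ hlM n t).trans ?_
    -- The extra power beyond `D` leaves a factor `1 / n` after the union over at most `K n ^ D` net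
    -- points.
    have h1 : (D + 1) * Real.log n ≤ n * (l / 4 * V G) := by
      have h2 : n * (l / 4 * (C ^ 2 * (Real.log n / n) / 4)) ≤ n * (l / 4 * V G) := by gcongr
      have h3 : n * (l / 4 * (C ^ 2 * (Real.log n / n) / 4)) =
          l * C ^ 2 / 16 * Real.log n := by field_simp; ring
      have h4 : (D + 1) * Real.log n ≤ l * C ^ 2 / 16 * Real.log n := by
        gcongr
        linarith
      linarith
    have h5 : Real.exp (l * t) / (n : ℝ) ^ (D + 1) =
        Real.exp (l * t - (D + 1) * Real.log n) := by
      rw [Real.exp_sub, ← Nat.cast_add_one, Real.exp_nat_mul, Real.exp_log hn1]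
    rw [h5]
    exact Real.exp_le_exp.2 (sub_le_sub_left h1 _)
  have hPU : P.real (⋃ G ∈ N', S G) ≤ δ / 2 := by
    refine (measureReal_biUnion_finset_le _ _).trans ((Finset.sum_le_sum hPS).trans ?_)
    rw [Finset.sum_const, nsmul_eq_mul]
    have hcard : (N'.card : ℝ) ≤ K * (n : ℝ) ^ D := by
      exact_mod_cast (Finset.card_filter_le _ _).trans hNcard
    calc _ ≤ K * (n : ℝ) ^ D * (Real.exp (l * t) / (n : ℝ) ^ (D + 1)) := by gcongr
      _ = K * Real.exp (l * t) / n := by field_simp; ring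
      _ ≤ δ / 2 := hn
  calc P _ ≤ P (A ∪ ⋃ G ∈ N', S G) := measure_mono_ae hsub
    _ = ENNReal.ofReal (P.real (A ∪ ⋃ G ∈ N', S G)) := (ofReal_measureReal).symm
    _ ≤ ENNReal.ofReal δ := by
      refine ENNReal.ofReal_le_ofReal ((measureReal_union_le _ _).trans ?_)
      linarith

/-! ### Application to the perturbed cosine router -/

theorem theorem3 {d₁ d₂ : ℕ}
    -- parameter space, input space, and distribution of the inputs
    (Θ : Set (ℝ × EuclideanSpace ℝ (Fin d₁) × EuclideanSpace ℝ (Fin d₂))) (hΘ : IsCompact Θ)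
    (𝒳 : Set (EuclideanSpace ℝ (Fin d₁))) (h𝒳 : Bornology.IsBounded 𝒳)
    (μ : Measure (EuclideanSpace ℝ (Fin d₁))) [IsProbabilityMeasure μ]
    (hμ : ∀ᵐ x ∂μ, x ∈ 𝒳)
    -- the noise hyper-parameters of the router
    (τ₁ τ₂ : ℝ) (hτ₁ : 0 < τ₁) (hτ₂ : 0 < τ₂)
    -- the expert function: measurable in the input, Lipschitz in its parameter, bounded
    (h : EuclideanSpace ℝ (Fin d₁) → EuclideanSpace ℝ (Fin d₂) → ℝ)
    (h_meas : ∀ θ ∈ Θ, Measurable fun x => h x θ.2.2)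
    (h_lip : ∃ L : ℝ≥0, ∀ x ∈ 𝒳, LipschitzOnWith L (h x) ((fun θ => θ.2.2) '' Θ))
    (h_bdd : ∃ M : ℝ, ∀ x ∈ 𝒳, ∀ θ ∈ Θ, |h x θ.2.2| ≤ M)
    -- the true mixing measure
    (Gstar : MixingParam d₁ d₂) (hk : 1 ≤ Gstar.size) (hGstar : Gstar.ParamsIn Θ)
    -- the sample: i.i.d. inputs and noise, the noise being `N(0, σ²)` given the input
    {Ω : Type*} [MeasurableSpace Ω] (P : Measure Ω) [IsProbabilityMeasure P]
    (σ : ℝ≥0)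
    (X : ℕ → Ω → EuclideanSpace ℝ (Fin d₁)) (ε : ℕ → Ω → ℝ) (Y : ℕ → Ω → ℝ)
    (h_indep : iIndepFun (fun i ω => (X i ω, ε i ω)) P)
    (h_law : ∀ i, HasLaw (fun ω => (X i ω, ε i ω)) (μ.prod (gaussianReal 0 (σ ^ 2))) P)
    (hY : ∀ i ω, Y i ω = Gstar.regression τ₁ τ₂ h (X i ω) + ε i ω) :
    -- exact-specified setting
    (∀ Gtilde : ℕ → Ω → MixingParam d₁ d₂,
      (∀ n, ∀ᵐ ω ∂P, IsLeastSquares τ₁ τ₂ h (exactClass Gstar.size Θ) n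
        (fun i => X i ω) (fun i => Y i ω) (Gtilde n ω)) →
      IsBigOInProbability P
        (fun n ω => eLpNorm ((Gtilde n ω).regression τ₁ τ₂ h - Gstar.regression τ₁ τ₂ h) 2 μ)
        (fun n => Real.sqrt (Real.log n / n))) ∧
    -- over-specified setting
    (∀ k : ℕ, Gstar.size < k → ∀ Gtilde : ℕ → Ω → MixingParam d₁ d₂,
      (∀ n, ∀ᵐ ω ∂P, IsLeastSquares τ₁ τ₂ h (overClass k Θ) n
        (fun i => X i ω) (fun i => Y i ω) (Gtilde n ω)) →
      IsBigOInProbability P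
        (fun n ω => eLpNorm ((Gtilde n ω).regression τ₁ τ₂ h - Gstar.regression τ₁ τ₂ h) 2 μ)
        (fun n => Real.sqrt (Real.log n / n))) := by
  obtain ⟨L, hL⟩ := h_lip
  obtain ⟨M, hM⟩ := h_bdd
  have h_bdd : ∀ x ∈ 𝒳, ∀ θ ∈ Θ, |h x θ.2.2| ≤ max M 0 := fun x hx θ hθ =>
    (hM x hx θ hθ).trans (le_max_left _ _)
  have hcover := hasPolynomialCover_exactClass hΘ.isBounded hτ₁ hτ₂ (le_max_right M 0) hL h_bdd
  have key : ∀ 𝓒 : Set (MixingParam d₁ d₂), (∀ G ∈ 𝓒, G.ParamsIn Θ) → Gstar ∈ 𝓒 →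
      HasPolynomialCover (fun G : MixingParam d₁ d₂ => G.regression τ₁ τ₂ h) 𝓒 𝒳 →
      ∀ Gtilde : ℕ → Ω → MixingParam d₁ d₂,
      (∀ n, ∀ᵐ ω ∂P, IsLeastSquares τ₁ τ₂ h 𝓒 n
        (fun i => X i ω) (fun i => Y i ω) (Gtilde n ω)) →
      IsBigOInProbability P
        (fun n ω => eLpNorm ((Gtilde n ω).regression τ₁ τ₂ h - Gstar.regression τ₁ τ₂ h) 2 μ)
        (fun n => Real.sqrt (Real.log n / n)) := by
    intro 𝓒 h𝓒 hG₀ hcov Gtilde hGt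
    exact isBigOInProbability_leastSquares
      (f := fun G : MixingParam d₁ d₂ => G.regression τ₁ τ₂ h) hμ
      (fun G hG => MixingParam.measurable_regression h_meas (h𝓒 G hG))
      (fun G hG x hx => MixingParam.abs_regression_le (le_max_right M 0) G
        fun i => h_bdd x hx _ (h𝓒 G hG i)) hcov hG₀ h_indep h_law hY hGt
  refine ⟨key _ (fun G hG => hG.2) ⟨rfl, hGstar⟩ (hcover _), fun k hk' => ?_⟩
  exact key _ (fun G hG => hG.2.2) ⟨hk, hk'.le, hGstar⟩ (hasPolynomialCover_overClass hcover k)
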